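/- **Proposition (Soundness of the abstraction).** *Setting.* Fix integers $n,d\ge 0$, $N,s\ge 1$, a number $l\in[1,\infty]$ with the $l$-norm $\|\cdot\|_l$, a finite set $A$ of actions and a confidence parameter $\beta\in(0,1)$. Consider the system $x_{k+1}=f_{a_k}(x_k,w_k)$ with states in $\mathbb R^n$ and disturbances in a bounded set $W\subset\mathbb R^d$, where $f_a:\mathbb R^n\times W\to\mathbb R^n$ satisfies $\|f_a(x,w)-f_a(x,w')\|_l\le L_w(x,a)\|w-w'\|_l$ for all $a\in A$, $x\in\mathbb R^n$, $w,w'\in W$, with constants $L_w(x,a)\ge 0$. The disturbances have law $P_w\in\mathcal P(W)$, and the transition kernel is $T^a(B\mid x)=\int_W \mathbf 1_B(f_a(x,v))\,P_w(dv)$. Let $w^{(1)},\dots,w^{(N)}$ be i.i.d. samples of $P_w$, defined on a probability space with probability $\mathbb P$, and $\widehat P_w=\frac1N\sum_{i=1}^N\delta_{w^{(i)}}$. *Radius.* For distributions $P,P'$ on a subset of $\mathbb R^d$ let $\mathcal T_s^{(l)}(P,P')=\inf_\pi\int\|v-v'\|_l^s\,\pi(dv,dv')$, the infimum being over all couplings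 $\pi$ of $P$ and $P'$. Let $\phi$ be the diameter of $W$ in the $\infty$-norm, and let $g=g(N,\phi,d,s,l)<\infty$ be any upper bound, uniform over all probability distributions $P$ carried by a bounded subset of $\mathbb R^d$ of $\infty$-norm diameter at most $\phi$, on the expected transport cost $\mathbb E[\mathcal T_s^{(l)}(P,\widehat P)]$ between $P$ and the empirical distribution $\widehat P$ of $N$ i.i.d. samples of $P$ (for instance the least such bound, which is finite). Put $$\varepsilon=\varepsilon(N,\beta)=g^{1/s}+\phi\,\kappa\,(2\log(1/\beta))^{\frac1{2s}}N^{-\frac1{2s}},\qquad \kappa=\max\bigl(\sqrt d,\;2^{-1/s}d^{1/l}\bigr),$$ with $d^{1/\infty}:=1$; thus $\kappa=\sqrt d$ whenever $l\ge2$ and $d\ge 1$. *Abstraction.* Let $X\subset\mathbb R^n$ be bounded and let $Q_{\rm safe}$ be a finite partition of $X$ into non-empty Borel cells; put $q_u=\mathbb R^n\setminus X$ and $Q=Q_{\rm safe}\cup\{q_u\}$. For $q\in Q_{\rm safe}$, $a\in A$ let $\mathrm{Reach}(q,a,w)=\{f_a(x,w):x\in q\}$ and let $\widehat\Gamma_{q,a}$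 be the set of all $\gamma\in\mathcal P(Q)$ such that, for every $q'\in Q$, $$\tfrac1N\bigl|\{i:\mathrm{Reach}(q,a,w^{(i)})\subseteq q'\}\bigr|\le\gamma(q')\le\tfrac1N\bigl|\{i:\mathrm{Reach}(q,a,w^{(i)})\cap q'\ne\emptyset\}\bigr|,$$ and let $\widehat\Gamma_{q_u,a}=\{\delta_{q_u}\}$. Let $c(q,q')=\inf\{\|x-x'\|_l^s:x\in q,\,x'\in q'\}$ on $Q\times Q$ (with $\inf\emptyset=\infty$ and $\infty\cdot 0=0$), let $\mathcal T^c$ be the corresponding optimal transport discrepancy on $\mathcal P(Q)$, and let $L_w(q,a)=\sup_{x\in q}L_w(x,a)$. The ambiguity sets of the robust Markov decision process are $$\Gamma_{q,a}=\bigl\{\gamma\in\mathcal P(Q):\ \exists\,\widehat\gamma\in\widehat\Gamma_{q,a},\ \mathcal T^c(\gamma,\widehat\gamma)\le (L_w(q,a)\,\varepsilon)^s\bigr\}\quad(q\in Q_{\rm safe}),\qquad \Gamma_{q_u,a}=\widehat\Gamma_{q_u,a}.$$ *Claim.* For $x\in X$ and $a\in A$ let $\gamma_{x,a}\in\mathcal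 P(Q)$ be given by $\gamma_{x,a}(q')=T^a(q'\mid x)$. Then $$\mathbb P\bigl(\gamma_{x,a}\in\Gamma_{q,a}\ \text{ for all } q\in Q,\ x\in q\cap X,\ a\in A\bigr)\ge 1-\beta .$$ (If this event is not measurable, the claim is that it contains a measurable event of probability at least $1-\beta$.) -/

import Mathlib

open MeasureTheory ProbabilityTheory
open scoped ENNReal NNReal

namespace RMDPAbstraction

noncomputable section

/-- The `l`-norm of a vector of `ℝ^m`, for `l ∈ [1, ∞]`. -/
def lnorm {m : ℕ} (l : ℝ≥0∞) (v : Fin m → ℝ) : ℝ :=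
  ‖(WithLp.toLp l v : PiLp l (fun _ : Fin m => ℝ))‖

/-- The cost `‖v - v'‖_l ^ s`. -/
def normCost {m : ℕ} (l : ℝ≥0∞) (s : ℕ) (v v' : Fin m → ℝ) : ℝ≥0∞ :=
  ENNReal.ofReal (lnorm l (v - v') ^ s)

/-! ### Optimal transport and empirical distributions -/

/-- The optimal transport discrepancy `𝒯_s^{(l)}(μ, ν)` of two distributions on a set
`V ⊆ ℝ^d`: the infimum of `∫ ‖v - v'‖_l ^ s dπ` over all couplings `π` of `μ` and `ν`. -/
def transportCost {d : ℕ} (l : ℝ≥0∞) (s : ℕ) {V : Set (Fin d → ℝ)} (μ ν : Measure V) : ℝ≥0∞ :=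
  ⨅ (π : Measure (V × V)) (_ : π.map Prod.fst = μ) (_ : π.map Prod.snd = ν),
    ∫⁻ z, normCost l s (z.1 : Fin d → ℝ) (z.2 : Fin d → ℝ) ∂π

/-- The empirical distribution `(1/N) ∑ i, δ_{w i}`. -/
def empirical {N : ℕ} {V : Type*} [MeasurableSpace V] (w : Fin N → V) : Measure V :=
  (N : ℝ≥0∞)⁻¹ • ∑ i, Measure.dirac (w i)

/-- The expected transport cost `𝔼[𝒯_s^{(l)}(P, P̂)]` between `P` and the empirical distribution
of `N` i.i.d. samples of `P`. -/
def meanCost {d : ℕ} (N : ℕ) (l : ℝ≥0∞) (s : ℕ) {V : Set (Fin d → ℝ)} (P : Measure V) : ℝ≥0∞ :=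
  ∫⁻ w, transportCost l s P (empirical w) ∂(Measure.pi fun _ : Fin N => P)

/-- The least upper bound of the expected transport costs that depends only on
`N, φ, d, s, l`: the supremum of `𝔼[𝒯_s^{(l)}(P, P̂)]` over all distributions `P` carried by a
bounded subset of `ℝ^d` of diameter at most `φ` in the `∞`-norm.
(The distance of `Fin d → ℝ` is the one of the `∞`-norm.) -/
def meanCostBound (N : ℕ) (φ : ℝ) (d s : ℕ) (l : ℝ≥0∞) : ℝ≥0∞ :=
  ⨆ (V : Set (Fin d → ℝ)) (_ : Bornology.IsBounded V) (_ : Metric.diam V ≤ φ)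
    (P : ProbabilityMeasure V), meanCost N l s (P : Measure V)

/-- The factor `κ` of the radius; it is `√d` as soon as `d ^ (1/l) ≤ 2 ^ (1/s) √d`,
in particular for every `l ≥ 2` and `d ≥ 1`. -/
def radiusFactor (d s : ℕ) (l : ℝ≥0∞) : ℝ :=
  max (Real.sqrt d) ((2 : ℝ) ^ (-(1 / (s : ℝ))) * (d : ℝ) ^ (1 / l).toReal)

/-- The radius `ε(N, β) = g^{1/s} + φ κ (2 log (1/β))^{1/(2s)} N^{-1/(2s)}`. -/
def radius (N : ℕ) (β φ : ℝ) (d s : ℕ) (l : ℝ≥0∞) (g : ℝ≥0) : ℝ :=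
  (g : ℝ) ^ (1 / (s : ℝ)) +
    φ * radiusFactor d s l * (2 * Real.log (1 / β)) ^ (1 / (2 * (s : ℝ)))
      * (N : ℝ) ^ (-(1 / (2 * (s : ℝ))))

/-! ### The switched system -/

/-- A switched system `x⁺ = f_a(x, w)` with states in `ℝ^n`, actions in `A` and disturbances in a
bounded set `W ⊆ ℝ^d`; `Lw x a` is a Lipschitz constant of `f_a(x, ·)` on `W`. -/
structure SwitchedSystem (n d : ℕ) (A : Type*) (l : ℝ≥0∞) where
  /-- the set of disturbances -/
  W : Set (Fin d → ℝ)
  bounded : Bornology.IsBounded W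
  /-- the vector fields -/
  f : A → (Fin n → ℝ) → W → (Fin n → ℝ)
  /-- the Lipschitz constants in the disturbance -/
  Lw : (Fin n → ℝ) → A → ℝ≥0
  lipschitz : ∀ (a : A) (x : Fin n → ℝ) (w w' : W),
    lnorm l (f a x w - f a x w') ≤ Lw x a * lnorm l ((w : Fin d → ℝ) - (w' : Fin d → ℝ))

/-- The transition kernel `T^a(B | x) = ∫ 1_B(f_a(x, v)) P(dv)`. -/
def SwitchedSystem.kernel {n d : ℕ} {A : Type*} {l : ℝ≥0∞} (S : SwitchedSystem n d A l)
    (P : Measure S.W) (a : A) (x : Fin n → ℝ) (B : Set (Fin n → ℝ)) : ℝ≥0∞ :=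
  ∫⁻ v, B.indicator 1 (S.f a x v) ∂P

theorem SwitchedSystem.continuous_f {n d : ℕ} {A : Type*} {l : ℝ≥0∞} [Fact (1 ≤ l)]
    (S : SwitchedSystem n d A l) (a : A) (x : Fin n → ℝ) : Continuous (S.f a x) := by
  have key : Continuous fun w : S.W =>
      (WithLp.toLp l (S.f a x w) : PiLp l (fun _ : Fin n => ℝ)) := by
    rw [continuous_iff_continuousAt]
    intro w₀
    rw [ContinuousAt, tendsto_iff_norm_sub_tendsto_zero]
    have hc : Continuous fun w : S.W => (S.Lw x a : ℝ) *
        ‖(WithLp.toLp l ((w : Fin d → ℝ) - (w₀ : Fin d → ℝ)) : PiLp l (fun _ : Fin d => ℝ))‖ :=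
      continuous_const.mul (((PiLp.continuous_toLp l (fun _ : Fin d => ℝ)).comp
        (continuous_subtype_val.sub continuous_const)).norm)
    have ht := hc.tendsto w₀
    simp only [sub_self, WithLp.toLp_zero, norm_zero, mul_zero] at ht
    refine squeeze_zero (fun _ => norm_nonneg _) (fun w => ?_) ht
    have h := S.lipschitz a x w w₀
    simpa only [lnorm, WithLp.toLp_sub] using h
  exact (PiLp.continuous_ofLp l (fun _ : Fin n => ℝ)).comp key

/-! ### States of the abstraction -/

/-- A finite partition of `X ⊆ ℝ^n` into non-empty disjoint Borel cells. -/
structure SafePartition {n : ℕ} (X : Set (Fin n → ℝ)) (ι : Type*) where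
  /-- the cells -/
  cell : ι → Set (Fin n → ℝ)
  nonempty : ∀ i, (cell i).Nonempty
  measurable : ∀ i, MeasurableSet (cell i)
  disjoint : Pairwise fun i j => Disjoint (cell i) (cell j)
  iUnion_eq : ⋃ i, cell i = X

/-- The states of the abstraction are `Q = Q_safe ∪ {q_u}`, here `Option ι`. The state `some i` is
the cell `i`, and `none` is the unsafe state `q_u = ℝ^n \ X`. -/
def SafePartition.region {n : ℕ} {X : Set (Fin n → ℝ)} {ι : Type*} (C : SafePartition X ι) :
    Option ι → Set (Fin n → ℝ)
  | some i => C.cell i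
  | none => Xᶜ

/-- The cost `c(q, q') = inf {‖x - x'‖_l ^ s : x ∈ q, x' ∈ q'}`. -/
def SafePartition.cost {n : ℕ} {X : Set (Fin n → ℝ)} {ι : Type*} (C : SafePartition X ι)
    (l : ℝ≥0∞) (s : ℕ) (q q' : Option ι) : ℝ≥0∞ :=
  ⨅ (x ∈ C.region q) (x' ∈ C.region q'), normCost l s x x'

/-- The optimal transport discrepancy `𝒯^c(γ, γ')` of two distributions on a finite set. -/
def discreteTransportCost {Q : Type*} [Fintype Q] (c : Q → Q → ℝ≥0∞) (γ γ' : PMF Q) : ℝ≥0∞ :=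
  ⨅ (π : PMF (Q × Q)) (_ : π.map Prod.fst = γ) (_ : π.map Prod.snd = γ'),
    ∑ z, c z.1 z.2 * π z

section Abstraction

variable {n d : ℕ} {A : Type*} {l : ℝ≥0∞} {X : Set (Fin n → ℝ)} {ι : Type*}

theorem SafePartition.measurable_region [Finite ι] (C : SafePartition X ι) (q : Option ι) :
    MeasurableSet (C.region q) := by
  cases q with
  | some i => exact C.measurable i
  | none =>
    have h : MeasurableSet X := by
      rw [← C.iUnion_eq]
      exact MeasurableSet.iUnion C.measurable
    exact h.compl

theorem SafePartition.iUnion_region (C : SafePartition X ι) : ⋃ q, C.region q = Set.univ := by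
  rw [Set.eq_univ_iff_forall]
  intro x
  rw [Set.mem_iUnion]
  by_cases hx : x ∈ X
  · rw [← C.iUnion_eq, Set.mem_iUnion] at hx
    obtain ⟨i, hi⟩ := hx
    exact ⟨some i, hi⟩
  · exact ⟨none, hx⟩

theorem SafePartition.disjoint_region (C : SafePartition X ι) :
    Pairwise fun q q' => Disjoint (C.region q) (C.region q') := by
  have hsub : ∀ i, C.cell i ⊆ X := fun i =>
    (Set.subset_iUnion C.cell i).trans C.iUnion_eq.subset
  intro q q' h
  cases q with
  | some i =>
    cases q' with
    | some j => exact C.disjoint fun hij => h (congrArg some hij)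
    | none => exact Set.disjoint_compl_right_iff_subset.mpr (hsub i)
  | none =>
    cases q' with
    | some j => exact (Set.disjoint_compl_right_iff_subset.mpr (hsub j)).symm
    | none => exact absurd rfl h

theorem sum_kernel_region [Fintype ι] [Fact (1 ≤ l)] (S : SwitchedSystem n d A l)
    (C : SafePartition X ι) (P : Measure S.W) [IsProbabilityMeasure P] (a : A) (x : Fin n → ℝ) :
    ∑ q, S.kernel P a x (C.region q) = 1 := by
  have hm : ∀ q, MeasurableSet (S.f a x ⁻¹' C.region q) := fun q =>
    (S.continuous_f a x).measurable (C.measurable_region q)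
  have hk : ∀ q, S.kernel P a x (C.region q) = P (S.f a x ⁻¹' C.region q) := fun q =>
    lintegral_indicator_one (hm q)
  have hd : Pairwise fun q q' =>
      Disjoint (S.f a x ⁻¹' C.region q) (S.f a x ⁻¹' C.region q') := fun q q' h =>
    (C.disjoint_region h).preimage _
  rw [Finset.sum_congr rfl fun q _ => hk q, ← tsum_fintype (L := .unconditional _),
    ← measure_iUnion hd hm, ← Set.preimage_iUnion, C.iUnion_region, Set.preimage_univ,
    measure_univ]

/-- The distribution `γ_{x,a}` on the states of the abstraction, `γ_{x,a}(q') = T^a(q' | x)`. -/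
def discreteTransition [Fintype ι] [Fact (1 ≤ l)] (S : SwitchedSystem n d A l)
    (C : SafePartition X ι) (P : Measure S.W) [IsProbabilityMeasure P] (x : Fin n → ℝ) (a : A) :
    PMF (Option ι) :=
  PMF.ofFintype (fun q' => S.kernel P a x (C.region q')) (sum_kernel_region S C P a x)

/-- `Reach(q, a, w) = {f_a(x, w) : x ∈ q}`. -/
def reach (S : SwitchedSystem n d A l) (C : SafePartition X ι) (q : Option ι) (a : A) (w : S.W) :
    Set (Fin n → ℝ) :=
  (fun x => S.f a x w) '' C.region q

open Classical in
/-- The lower transition probability bounds of the empirical interval MDP; the unsafe state is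
absorbing. -/
def lowerBound {N : ℕ} (S : SwitchedSystem n d A l) (C : SafePartition X ι) (w : Fin N → S.W) :
    Option ι → A → Option ι → ℝ≥0∞
  | some i, a, q' => ({k | reach S C (some i) a (w k) ⊆ C.region q'}.ncard : ℝ≥0∞) / N
  | none, _, q' => if q' = none then 1 else 0

open Classical in
/-- The upper transition probability bounds of the empirical interval MDP; the unsafe state is
absorbing. -/
def upperBound {N : ℕ} (S : SwitchedSystem n d A l) (C : SafePartition X ι) (w : Fin N → S.W) :
    Option ι → A → Option ι → ℝ≥0∞
  | some i, a, q' => ({k | (reach S C (some i) a (w k) ∩ C.region q').Nonempty}.ncard : ℝ≥0∞) / N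
  | none, _, q' => if q' = none then 1 else 0

/-- The set `Γ̂_{q,a}` of transition distributions of the empirical interval MDP. -/
def empiricalSet {N : ℕ} (S : SwitchedSystem n d A l) (C : SafePartition X ι) (w : Fin N → S.W)
    (q : Option ι) (a : A) : Set (PMF (Option ι)) :=
  {γ | ∀ q', lowerBound S C w q a q' ≤ γ q' ∧ γ q' ≤ upperBound S C w q a q'}

/-- `L_w(q, a) = sup {L_w(x, a) : x ∈ q}`. -/
def cellLipschitz (S : SwitchedSystem n d A l) (C : SafePartition X ι) (q : Option ι) (a : A) :
    ℝ≥0∞ :=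
  ⨆ x ∈ C.region q, (S.Lw x a : ℝ≥0∞)

/-- The ambiguity set `Γ_{q,a}` of the robust MDP with radius `ε`: for `q ∈ Q_safe`, the
distributions within transport cost `(L_w(q,a) ε)^s` of `Γ̂_{q,a}`; the unsafe state is
absorbing. -/
def ambiguitySet {N : ℕ} [Fintype ι] (S : SwitchedSystem n d A l) (C : SafePartition X ι)
    (s : ℕ) (ε : ℝ) (w : Fin N → S.W) : Option ι → A → Set (PMF (Option ι))
  | some i, a => {γ | ∃ γ' ∈ empiricalSet S C w (some i) a,
      discreteTransportCost (C.cost l s) γ γ' ≤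
        (cellLipschitz S C (some i) a * ENNReal.ofReal ε) ^ s}
  | none, a => empiricalSet S C w none a

end Abstraction

end

end RMDPAbstraction

open RMDPAbstraction

/-! Everything reduces to one event: some coupling `π` of `P` and the empirical distribution has
cost at most `ε ^ s`. On it, fix `x` in a cell `q` and an action `a`, and push both coordinates of
`π` forward under the map from `v` to the state containing `f_a(x, v)`. The first marginal becomes
`γ_{x,a}`. The second becomes the frequencies of the states hit by `f_a(x, w k)`, which respect the
interval bounds because `x ∈ q`. The cost grows at most by the factor `Lw x a ^ s`, since the cost
between cells is an infimum over points (`discreteTransition_mem_ambiguitySet`). One `π` serves all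
`x`, `q`, `a`, so no union bound is needed.

The event is likely by McDiarmid's inequality. A coupling with an empirical distribution is a
mixture of `ρ k ⊗ δ_{w k}` (`exists_eq_mixture`), where the constraint on `ρ` does not involve the
samples. Hence changing one sample changes the transport cost by at most `D / N`, with `D = (d ^
(1/l) φ) ^ s`, and the cost is upper semicontinuous in the samples, so measurable. As its mean is at
most `g`, it reaches `g + D √(log (1/β) / (2N))` with probability at most `β`; superadditivity of
the `s`-th power bounds this level by `ε ^ s` (`add_deviation_le_radius_pow`). -/

/-! ### The bounded difference inequality -/

/-- Hoeffding's lemma for a function whose oscillation is at most `c`. -/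
theorem hasSubgaussianMGF_of_oscillation_le {V : Type*} [MeasurableSpace V] (P : Measure V)
    [IsProbabilityMeasure P] {h : V → ℝ} (hm : Measurable h) {c : ℝ≥0}
    (hc : ∀ u v, h u ≤ h v + c) :
    HasSubgaussianMGF (fun v => h v - ∫ u, h u ∂P) ((c / 2) ^ 2) P := by
  have hne : Nonempty V := nonempty_of_isProbabilityMeasure P
  have v₀ : V := hne.some
  have hbdd : BddBelow (Set.range h) := ⟨h v₀ - c, by
    rintro _ ⟨v, rfl⟩
    linarith [hc v₀ v]⟩
  -- The range lies in an interval of length `c` that starts at the infimum, which is the form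
  -- Hoeffding's lemma takes.
  have hmem : ∀ v, h v ∈ Set.Icc (⨅ u, h u) ((⨅ u, h u) + c) := by
    intro v
    refine ⟨ciInf_le hbdd v, ?_⟩
    have : h v - c ≤ ⨅ u, h u := le_ciInf fun u => by linarith [hc v u]
    linarith
  have := hasSubgaussianMGF_of_mem_Icc (μ := P) hm.aemeasurable (Filter.Eventually.of_forall hmem)
  simpa using this

/-- McDiarmid's inequality, as a bound of the moment generating function. -/
theorem hasSubgaussianMGF_pi_of_boundedDifference {V : Type*} [MeasurableSpace V] (P : Measure V)
    [IsProbabilityMeasure P] {B : ℝ} {c : ℝ≥0} {N : ℕ} {F : (Fin N → V) → ℝ} (hm : Measurable F)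
    (hB : ∀ w, |F w| ≤ B) (hc : ∀ w i v, F (Function.update w i v) ≤ F w + c) :
    HasSubgaussianMGF (fun w => F w - ∫ u, F u ∂(Measure.pi fun _ : Fin N => P))
      (N * (c / 2) ^ 2) (Measure.pi fun _ : Fin N => P) := by
  induction N with
  | zero =>
    have h0 : ∀ w, F w - ∫ u, F u ∂(Measure.pi fun _ : Fin 0 => P) = 0 := by
      intro w
      have : F = fun _ => F w := funext fun u => congrArg F (Subsingleton.elim _ _)
      rw [this]
      simp
    simp only [h0]
    simp
  | succ N ih =>
    set Q := Measure.pi fun _ : Fin N => P with hQ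
    have hcm : Measurable fun z : V × (Fin N → V) => (Fin.cons z.1 z.2 : Fin (N + 1) → V) := by
      refine measurable_pi_iff.2 fun i => ?_
      refine Fin.cases ?_ (fun j => ?_) i
      · simpa using measurable_fst
      · exact (measurable_pi_apply j).comp measurable_snd
    have hmp : MeasurePreserving (MeasurableEquiv.piFinSuccAbove (fun _ : Fin (N + 1) => V) 0).symm
        (P.prod Q) (Measure.pi fun _ : Fin (N + 1) => P) :=
      (measurePreserving_piFinSuccAbove (fun _ : Fin (N + 1) => P) 0).symm
    have hint : ∀ H : (Fin (N + 1) → V) → ℝ,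
        ∫ z, H z ∂(Measure.pi fun _ : Fin (N + 1) => P)
          = ∫ z, H (Fin.cons z.1 z.2) ∂(P.prod Q) := by
      intro H
      rw [← hmp.integral_comp']
      refine integral_congr_ae (Filter.Eventually.of_forall fun z => congrArg H ?_)
      exact Fin.insertNth_zero' z.1 z.2
    set F' : V × (Fin N → V) → ℝ := fun z => F (Fin.cons z.1 z.2) with hF'
    have hF'm : Measurable F' := hm.comp hcm
    have hF'B : ∀ z, |F' z| ≤ B := fun z => hB _
    have hF'i : Integrable F' (P.prod Q) :=
      Integrable.of_bound hF'm.aestronglyMeasurable B (Filter.Eventually.of_forall hF'B)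
    have hsec : ∀ w, Measurable fun v => F' (v, w) := fun w => hF'm.comp measurable_prodMk_right
    have hseci : ∀ w, Integrable (fun v => F' (v, w)) P := fun w =>
      Integrable.of_bound (hsec w).aestronglyMeasurable B (Filter.Eventually.of_forall fun v => hF'B _)
    -- Averaging over the first coordinate keeps the mean, the bound `B` and the oscillation `c`, so
    -- the induction hypothesis applies to `G`.
    set G : (Fin N → V) → ℝ := fun w => ∫ v, F' (v, w) ∂P with hG
    have hGm : Measurable G := by
      exact (hF'm.stronglyMeasurable.integral_prod_left').measurable
    have hGB : ∀ w, |G w| ≤ B := by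
      intro w
      have := norm_integral_le_of_norm_le_const (μ := P) (f := fun v => F' (v, w)) (C := B)
        (Filter.Eventually.of_forall fun v => hF'B _)
      simpa using this
    have hGc : ∀ w i v, G (Function.update w i v) ≤ G w + c := by
      intro w i v
      have : ∫ u, (F' (u, w) + c) ∂P = G w + c := by
        rw [integral_add (hseci w) (integrable_const _)]
        simp [hG]
      rw [← this]
      refine integral_mono (hseci _) ((hseci w).add (integrable_const _)) fun u => ?_
      simp only [hF', Fin.cons_update]
      exact hc _ _ _
    have hEF : ∫ u, F u ∂(Measure.pi fun _ : Fin (N + 1) => P) = ∫ w, G w ∂Q := by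
      rw [hint, integral_prod_symm _ hF'i]
    have hGs := ih hGm hGB hGc
    set m := ∫ w, G w ∂Q with hmdef
    rw [hEF]
    have hexp : ∀ t : ℝ, ∀ {Z : Type _} [MeasurableSpace Z] (ν : Measure Z) [IsFiniteMeasure ν]
        (H : Z → ℝ), Measurable H → (∀ z, |H z| ≤ B) →
        Integrable (fun z => Real.exp (t * (H z - m))) ν := by
      intro t Z _ ν _ H hH hHB
      refine integrable_exp_mul_of_mem_Icc (a := -B - m) (b := B - m)
        (hH.sub_const m).aemeasurable (Filter.Eventually.of_forall fun z => ?_)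
      have := abs_le.1 (hHB z)
      constructor <;> linarith [this.1, this.2]
    refine ⟨fun t => hexp t _ F hm hB, fun t => ?_⟩
    -- For fixed `w`, the deviation is `(G w - m) + (F' (v, w) - G w)`; the second part is centred
    -- in `v` and is controlled by Hoeffding's lemma.
    have hsplit : ∀ w, ∫ v, Real.exp (t * (F' (v, w) - m)) ∂P
        = Real.exp (t * (G w - m)) * mgf (fun v => F' (v, w) - G w) P t := by
      intro w
      rw [mgf, ← integral_const_mul]
      refine integral_congr_ae (Filter.Eventually.of_forall fun v => ?_)
      simp only [← Real.exp_add]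
      congr 1
      ring
    have hsecc : ∀ w u v, F' (u, w) ≤ F' (v, w) + c := by
      intro w u v
      have := hc (Fin.cons v w) 0 u
      simpa [hF', Fin.update_cons_zero] using this
    calc mgf (fun w => F w - m) (Measure.pi fun _ : Fin (N + 1) => P) t
        = ∫ w, ∫ v, Real.exp (t * (F' (v, w) - m)) ∂P ∂Q := by
          rw [mgf, hint, integral_prod_symm _ (hexp t (P.prod Q) F' hF'm hF'B)]
      _ ≤ ∫ w, Real.exp (t * (G w - m)) * Real.exp (((c / 2) ^ 2 : ℝ≥0) * t ^ 2 / 2) ∂Q := by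
          refine integral_mono (hexp t (P.prod Q) F' hF'm hF'B).integral_prod_right
            ((hexp t Q G hGm hGB).mul_const _) fun w => ?_
          simp only [hsplit]
          refine mul_le_mul_of_nonneg_left ?_ (Real.exp_pos _).le
          exact (hasSubgaussianMGF_of_oscillation_le P (hsec w) (hsecc w)).mgf_le t
      _ = mgf (fun w => G w - m) Q t * Real.exp (((c / 2) ^ 2 : ℝ≥0) * t ^ 2 / 2) := by
          rw [mgf, integral_mul_const]
      _ ≤ Real.exp ((N * (c / 2) ^ 2 : ℝ≥0) * t ^ 2 / 2)
            * Real.exp (((c / 2) ^ 2 : ℝ≥0) * t ^ 2 / 2) :=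
          mul_le_mul_of_nonneg_right (hGs.mgf_le t) (Real.exp_pos _).le
      _ = Real.exp (((N + 1 : ℕ) * (c / 2) ^ 2 : ℝ≥0) * t ^ 2 / 2) := by
          rw [← Real.exp_add]
          congr 1
          push_cast
          ring

/-! ### The cost -/

theorem continuous_lnorm {m : ℕ} (l : ℝ≥0∞) [Fact (1 ≤ l)] :
    Continuous (lnorm l : (Fin m → ℝ) → ℝ) :=
  (PiLp.continuous_toLp l (fun _ : Fin m => ℝ)).norm

theorem lnorm_nonneg {m : ℕ} (l : ℝ≥0∞) [Fact (1 ≤ l)] (v : Fin m → ℝ) : 0 ≤ lnorm l v :=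
  norm_nonneg _

theorem continuous_normCost {m : ℕ} (l : ℝ≥0∞) [Fact (1 ≤ l)] (s : ℕ) {Z : Type*}
    [TopologicalSpace Z] {f g : Z → Fin m → ℝ} (hf : Continuous f) (hg : Continuous g) :
    Continuous fun z => normCost l s (f z) (g z) :=
  ENNReal.continuous_ofReal.comp (((continuous_lnorm l).comp (hf.sub hg)).pow s)

/-- The `l`-norm is at most `m ^ (1/l)` times the `∞`-norm. -/
theorem lnorm_sub_le {m : ℕ} (l : ℝ≥0∞) [Fact (1 ≤ l)] (v v' : Fin m → ℝ) :
    lnorm l (v - v') ≤ (m : ℝ) ^ (1 / l).toReal * dist v v' := by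
  have h := (PiLp.lipschitzWith_toLp l (fun _ : Fin m => ℝ)).dist_le_mul v v'
  rw [dist_eq_norm, ← WithLp.toLp_sub] at h
  simpa [lnorm] using h

theorem normCost_le {m : ℕ} (l : ℝ≥0∞) [Fact (1 ≤ l)] (s : ℕ) {V : Set (Fin m → ℝ)}
    (hV : Bornology.IsBounded V) (v v' : V) :
    normCost l s (v : Fin m → ℝ) (v' : Fin m → ℝ)
      ≤ ENNReal.ofReal (((m : ℝ) ^ (1 / l).toReal * Metric.diam V) ^ s) := by
  refine ENNReal.ofReal_le_ofReal (pow_le_pow_left₀ (lnorm_nonneg l _) ?_ s)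
  refine (lnorm_sub_le l _ _).trans (mul_le_mul_of_nonneg_left ?_ (by positivity))
  exact Metric.dist_le_diam_of_mem hV v.2 v'.2

/-! ### Couplings with an empirical distribution -/

section Mixture

variable {V : Type*} [MeasurableSpace V] {N : ℕ}

/-- The mixture `(1/N) ∑ k, ρ k ⊗ δ_{w k}`. -/
noncomputable def mixture (w : Fin N → V) (ρ : Fin N → Measure V) : Measure (V × V) :=
  (N : ℝ≥0∞)⁻¹ • ∑ k, (ρ k).map fun v => (v, w k)

theorem map_fst_mixture (w : Fin N → V) (ρ : Fin N → Measure V) :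
    (mixture w ρ).map Prod.fst = (N : ℝ≥0∞)⁻¹ • ∑ k, ρ k := by
  have hm : ∀ k, Measurable fun v : V => (v, w k) := fun k => measurable_prodMk_right
  rw [mixture, Measure.map_smul, Measure.map_finset_sum measurable_fst.aemeasurable]
  congr 1
  refine Finset.sum_congr rfl fun k _ => ?_
  rw [Measure.map_map measurable_fst (hm k)]
  exact Measure.map_id

theorem map_snd_mixture (w : Fin N → V) (ρ : Fin N → Measure V)
    [∀ k, IsProbabilityMeasure (ρ k)] : (mixture w ρ).map Prod.snd = empirical w := by
  have hm : ∀ k, Measurable fun v : V => (v, w k) := fun k => measurable_prodMk_right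
  rw [mixture, Measure.map_smul, Measure.map_finset_sum measurable_snd.aemeasurable, empirical]
  congr 1
  refine Finset.sum_congr rfl fun k _ => ?_
  rw [Measure.map_map measurable_snd (hm k)]
  have : (Prod.snd ∘ fun v : V => (v, w k)) = fun _ => w k := rfl
  rw [this, Measure.map_const, measure_univ, one_smul]

theorem lintegral_mixture (w : Fin N → V) (ρ : Fin N → Measure V) {h : V × V → ℝ≥0∞}
    (hh : Measurable h) :
    ∫⁻ z, h z ∂(mixture w ρ) = (N : ℝ≥0∞)⁻¹ * ∑ k, ∫⁻ v, h (v, w k) ∂(ρ k) := by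
  rw [mixture, lintegral_smul_measure, lintegral_finsetSum_measure, smul_eq_mul]
  congr 1
  exact Finset.sum_congr rfl fun k _ => lintegral_map hh measurable_prodMk_right

open Classical in
/-- Every coupling with an empirical distribution is a mixture. -/
theorem exists_eq_mixture [MeasurableSingletonClass V] (hN : N ≠ 0) (w : Fin N → V)
    (π : Measure (V × V)) (hπ : π.map Prod.snd = empirical w) :
    ∃ ρ : Fin N → Measure V, (∀ k, IsProbabilityMeasure (ρ k)) ∧ π = mixture w ρ := by
  have hN0 : (N : ℝ≥0∞) ≠ 0 := by exact_mod_cast hN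
  have hNt : (N : ℝ≥0∞) ≠ ∞ := ENNReal.natCast_ne_top N
  set fib : V → Set (V × V) := fun u => Prod.snd ⁻¹' {u} with hfib
  have hfm : ∀ u, MeasurableSet (fib u) := fun u => measurable_snd (measurableSet_singleton u)
  -- Samples may coincide, so the fibres are indexed by points, and multiplicities are counted.
  set cnt : V → ℕ := fun u => (Finset.univ.filter fun k => w k = u).card with hcnt
  have hmass : ∀ u, π (fib u) = (N : ℝ≥0∞)⁻¹ * cnt u := by
    intro u
    rw [hfib, ← Measure.map_apply measurable_snd (measurableSet_singleton u), hπ, empirical,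
      Measure.smul_apply, Measure.finsetSum_apply, smul_eq_mul]
    congr 1
    simp [Set.indicator_apply, hcnt]
  have hcnt0 : ∀ k, (cnt (w k) : ℝ≥0∞) ≠ 0 := by
    intro k
    have : cnt (w k) ≠ 0 := Finset.card_ne_zero_of_mem (a := k) (by simp)
    exact_mod_cast this
  have hm0 : ∀ k, π (fib (w k)) ≠ 0 := fun k => by
    rw [hmass]
    exact mul_ne_zero (ENNReal.inv_ne_zero.2 hNt) (hcnt0 k)
  have hmt : ∀ k, π (fib (w k)) ≠ ∞ := fun k => by
    rw [hmass]
    exact ENNReal.mul_ne_top (ENNReal.inv_ne_top.2 hN0) (ENNReal.natCast_ne_top _)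
  -- The conditional law of the first coordinate given that the second is `u`; equal samples receive
  -- the same law.
  set τ : V → Measure V := fun u => (π (fib u))⁻¹ • (π.restrict (fib u)).map Prod.fst with hτ
  refine ⟨fun k => τ (w k), fun k => ⟨?_⟩, ?_⟩
  · rw [hτ, Measure.smul_apply, Measure.map_apply measurable_fst MeasurableSet.univ,
      Set.preimage_univ, Measure.restrict_apply_univ, smul_eq_mul]
    exact ENNReal.inv_mul_cancel (hm0 k) (hmt k)
  · have hback : ∀ u, ((π.restrict (fib u)).map Prod.fst).map (fun v => (v, u))
        = π.restrict (fib u) := by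
      intro u
      rw [Measure.map_map measurable_prodMk_right measurable_fst]
      conv_rhs => rw [← Measure.map_id (μ := π.restrict (fib u))]
      refine Measure.map_congr ?_
      filter_upwards [ae_restrict_mem (hfm u)] with z hz
      have : z.2 = u := hz
      simp [← this]
    have hnull : π (⋃ u ∈ Finset.univ.image w, fib u)ᶜ = 0 := by
      have hset : (⋃ u ∈ Finset.univ.image w, fib u)ᶜ = Prod.snd ⁻¹' (Set.range w)ᶜ := by
        ext z
        simp [hfib, eq_comm]
      have hr : MeasurableSet (Set.range w)ᶜ := (Set.finite_range w).measurableSet.compl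
      rw [hset, ← Measure.map_apply measurable_snd hr, hπ, empirical, Measure.smul_apply,
        Measure.finsetSum_apply]
      simp
    have hdec : π = ∑ u ∈ Finset.univ.image w, π.restrict (fib u) := by
      have h1 : π.restrict (⋃ u ∈ Finset.univ.image w, fib u) = π :=
        Measure.restrict_eq_self_of_ae_mem (by
          rw [ae_iff]
          exact hnull)
      have hd : Set.PairwiseDisjoint (↑(Finset.univ.image w)) fib := by
        intro u _ u' _ huu
        refine Set.disjoint_left.2 fun z hz hz' => huu ?_
        exact (show z.2 = u from hz).symm.trans hz'
      conv_lhs => rw [← h1]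
      rw [Measure.restrict_biUnion_finset hd hfm]
      exact Measure.sum_coe_finset _ fun u => π.restrict (fib u)
    -- Grouping the indices by the value of `w`, the multiplicity divided by `N` cancels the
    -- normalisation of `τ`.
    rw [mixture, Finset.sum_comp (fun u => (τ u).map fun v => (v, u)) w, Finset.smul_sum]
    conv_lhs => rw [hdec]
    refine Finset.sum_congr rfl fun u hu => ?_
    obtain ⟨k, -, rfl⟩ := Finset.mem_image.1 hu
    have hc' : (N : ℝ≥0∞)⁻¹ * ((Finset.univ.filter fun j => w j = w k).card : ℝ≥0∞)
        * (π (fib (w k)))⁻¹ = 1 := by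
      rw [← hmass]
      exact ENNReal.mul_inv_cancel (hm0 k) (hmt k)
    rw [hτ, Measure.map_smul, hback, ← Nat.cast_smul_eq_nsmul ℝ≥0∞, smul_smul, smul_smul, hc', one_smul]

end Mixture

/-! ### The transport cost to the empirical distribution -/

section TransportCost

variable {d N : ℕ} {l : ℝ≥0∞} [Fact (1 ≤ l)] {V : Set (Fin d → ℝ)}

theorem measurable_normCost_subtype (s : ℕ) :
    Measurable fun z : V × V => normCost l s (z.1 : Fin d → ℝ) (z.2 : Fin d → ℝ) :=
  (continuous_normCost l s (continuous_subtype_val.comp continuous_fst)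
    (continuous_subtype_val.comp continuous_snd)).measurable

/-- The transport cost to an empirical distribution is an infimum over families of conditional
distributions. -/
theorem transportCost_empirical_eq (hN : N ≠ 0) (s : ℕ) (P : Measure V) (w : Fin N → V) :
    transportCost l s P (empirical w)
      = ⨅ (ρ : Fin N → Measure V) (_ : ∀ k, IsProbabilityMeasure (ρ k))
          (_ : (N : ℝ≥0∞)⁻¹ • ∑ k, ρ k = P),
          (N : ℝ≥0∞)⁻¹ * ∑ k, ∫⁻ v, normCost l s (v : Fin d → ℝ) (w k : Fin d → ℝ) ∂(ρ k) := by
  refine le_antisymm ?_ ?_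
  · refine le_iInf fun ρ => le_iInf fun hρ => le_iInf fun hP => ?_
    rw [← lintegral_mixture w ρ (measurable_normCost_subtype s)]
    refine iInf_le_of_le (mixture w ρ) (iInf_le_of_le ?_ (iInf_le_of_le ?_ le_rfl))
    · rw [map_fst_mixture, hP]
    · exact map_snd_mixture w ρ
  · refine le_iInf fun π => le_iInf fun h1 => le_iInf fun h2 => ?_
    obtain ⟨ρ, hρ, rfl⟩ := exists_eq_mixture hN w π h2
    rw [lintegral_mixture w ρ (measurable_normCost_subtype s)]
    refine iInf_le_of_le ρ (iInf_le_of_le hρ (iInf_le_of_le ?_ le_rfl))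
    rw [← map_fst_mixture w ρ, h1]

theorem continuous_lintegral_normCost (s : ℕ) (hV : Bornology.IsBounded V) (ρ : Measure V)
    [IsProbabilityMeasure ρ] : Continuous fun u : V =>
      ∫⁻ v : V, normCost l s (v : Fin d → ℝ) (u : Fin d → ℝ) ∂ρ := by
  rw [continuous_iff_seqContinuous]
  intro u u₀ hu
  have hmeas : ∀ y : V, Measurable fun v : V => normCost l s (v : Fin d → ℝ) (y : Fin d → ℝ) :=
    fun y => (continuous_normCost l s continuous_subtype_val continuous_const).measurable
  have hlim : ∀ v : V, Filter.Tendsto (fun k => normCost l s (v : Fin d → ℝ) (u k : Fin d → ℝ))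
      Filter.atTop (nhds (normCost l s (v : Fin d → ℝ) (u₀ : Fin d → ℝ))) := fun v =>
    ((continuous_normCost l s continuous_const continuous_subtype_val).tendsto u₀).comp hu
  have hfin : ∫⁻ _ : V, ENNReal.ofReal (((d : ℝ) ^ (1 / l).toReal * Metric.diam V) ^ s) ∂ρ ≠ ∞ := by
    rw [lintegral_const, measure_univ, mul_one]
    exact ENNReal.ofReal_ne_top
  exact tendsto_lintegral_of_dominated_convergence _ (fun k => hmeas (u k))
    (fun k => Filter.Eventually.of_forall fun v => normCost_le l s hV v (u k)) hfin
    (Filter.Eventually.of_forall hlim)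

/-- The infimum runs over an uncountable family, so measurability comes from topology: the
admissible `ρ` do not depend on `w`, and an infimum of continuous functions is upper semicontinuous.
-/
theorem measurable_transportCost_empirical (hN : N ≠ 0) (s : ℕ) (hV : Bornology.IsBounded V)
    (P : Measure V) : Measurable fun w : Fin N → V => transportCost l s P (empirical w) := by
  simp only [transportCost_empirical_eq hN]
  refine UpperSemicontinuous.measurable ?_
  refine upperSemicontinuous_iInf fun ρ => upperSemicontinuous_iInf fun hρ =>
    upperSemicontinuous_iInf fun _ => Continuous.upperSemicontinuous ?_
  refine ENNReal.continuous_const_mul (ENNReal.inv_ne_top.2 (by exact_mod_cast hN)) |>.comp ?_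
  refine continuous_finsetSum _ fun k _ => ?_
  exact (continuous_lintegral_normCost s hV (ρ k)).comp (continuous_apply k)

/-- The independent coupling, `ρ k = P` for every `k`, is admissible, and no unit of mass costs more
than the diameter allows. -/
theorem transportCost_empirical_le (hN : N ≠ 0) (s : ℕ) (hV : Bornology.IsBounded V)
    (P : Measure V) [IsProbabilityMeasure P] (w : Fin N → V) :
    transportCost l s P (empirical w)
      ≤ ENNReal.ofReal (((d : ℝ) ^ (1 / l).toReal * Metric.diam V) ^ s) := by
  have hN0 : (N : ℝ≥0∞) ≠ 0 := by exact_mod_cast hN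
  have hNt : (N : ℝ≥0∞) ≠ ∞ := ENNReal.natCast_ne_top N
  rw [transportCost_empirical_eq hN]
  refine iInf_le_of_le (fun _ => P) (iInf_le_of_le (fun _ => inferInstance) (iInf_le_of_le ?_ ?_))
  · rw [Finset.sum_const, Finset.card_univ, Fintype.card_fin, ← Nat.cast_smul_eq_nsmul ℝ≥0∞,
      smul_smul, ENNReal.inv_mul_cancel hN0 hNt, one_smul]
  · set K := ENNReal.ofReal (((d : ℝ) ^ (1 / l).toReal * Metric.diam V) ^ s)
    calc _ ≤ (N : ℝ≥0∞)⁻¹ * ∑ _k : Fin N, K := by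
          gcongr with k
          refine (lintegral_mono fun v => normCost_le l s hV v (w k)).trans ?_
          simp [K]
      _ = K := by
          rw [Finset.sum_const, Finset.card_univ, Fintype.card_fin, nsmul_eq_mul, ← mul_assoc,
            ENNReal.inv_mul_cancel hN0 hNt, one_mul]

/-- The same `ρ` is admissible before and after the update; only the `i`-th term changes, and it
carries weight `1 / N`. -/
theorem transportCost_empirical_update_le (hN : N ≠ 0) (s : ℕ) (hV : Bornology.IsBounded V)
    (P : Measure V) (w : Fin N → V) (i : Fin N) (u : V) :
    transportCost l s P (empirical (Function.update w i u))
      ≤ transportCost l s P (empirical w)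
        + (N : ℝ≥0∞)⁻¹ * ENNReal.ofReal (((d : ℝ) ^ (1 / l).toReal * Metric.diam V) ^ s) := by
  set K := ENNReal.ofReal (((d : ℝ) ^ (1 / l).toReal * Metric.diam V) ^ s)
  simp only [transportCost_empirical_eq hN, ENNReal.iInf_add]
  refine le_iInf fun ρ => le_iInf fun hρ => le_iInf fun hP => ?_
  refine iInf_le_of_le ρ (iInf_le_of_le hρ (iInf_le_of_le hP ?_))
  rw [← mul_add]
  gcongr
  calc ∑ k, ∫⁻ v, normCost l s (v : Fin d → ℝ) (Function.update w i u k : Fin d → ℝ) ∂(ρ k)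
      ≤ ∑ k, (∫⁻ v, normCost l s (v : Fin d → ℝ) (w k : Fin d → ℝ) ∂(ρ k)
          + if k = i then K else 0) := by
        refine Finset.sum_le_sum fun k _ => ?_
        by_cases hk : k = i
        · rw [if_pos hk]
          refine le_add_left ?_
          refine (lintegral_mono fun v => normCost_le l s hV v _).trans ?_
          simp [K]
        · simp [hk]
    _ = _ := by simp [Finset.sum_add_distrib]

end TransportCost

/-! ### Transfer of couplings to the abstraction -/

section Abstraction

variable {n d N : ℕ} {A ι : Type*} {l : ℝ≥0∞} {X : Set (Fin n → ℝ)}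

/-- The state of the abstraction that contains a given point. -/
noncomputable def SafePartition.index (C : SafePartition X ι) (y : Fin n → ℝ) : Option ι :=
  (Set.mem_iUnion.1 (C.iUnion_region.symm ▸ Set.mem_univ y : y ∈ ⋃ q, C.region q)).choose

theorem SafePartition.mem_region_index (C : SafePartition X ι) (y : Fin n → ℝ) :
    y ∈ C.region (SafePartition.index C y) :=
  (Set.mem_iUnion.1 (C.iUnion_region.symm ▸ Set.mem_univ y : y ∈ ⋃ q, C.region q)).choose_spec

theorem SafePartition.index_eq_iff (C : SafePartition X ι) {y : Fin n → ℝ} {q : Option ι} :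
    SafePartition.index C y = q ↔ y ∈ C.region q := by
  refine ⟨fun h => h ▸ SafePartition.mem_region_index C y, fun h => ?_⟩
  by_contra hne
  exact Set.disjoint_left.1 (C.disjoint_region hne) (SafePartition.mem_region_index C y) h

theorem SafePartition.cost_index_le (C : SafePartition X ι) (s : ℕ) (y y' : Fin n → ℝ) :
    C.cost l s (SafePartition.index C y) (SafePartition.index C y') ≤ normCost l s y y' :=
  iInf₂_le_of_le y (SafePartition.mem_region_index C y)
    (iInf₂_le y' (SafePartition.mem_region_index C y'))

variable [Fact (1 ≤ l)]

theorem normCost_f_le (S : SwitchedSystem n d A l) (s : ℕ) (a : A) (x : Fin n → ℝ) (v v' : S.W) :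
    normCost l s (S.f a x v) (S.f a x v')
      ≤ (S.Lw x a : ℝ≥0∞) ^ s * normCost l s (v : Fin d → ℝ) (v' : Fin d → ℝ) := by
  rw [normCost, normCost, ← ENNReal.ofReal_coe_nnreal, ← ENNReal.ofReal_pow (by positivity),
    ← ENNReal.ofReal_mul (by positivity), ← mul_pow]
  exact ENNReal.ofReal_le_ofReal (pow_le_pow_left₀ (lnorm_nonneg l _) (S.lipschitz a x v v') s)

variable [Fintype ι]

theorem discreteTransition_apply (S : SwitchedSystem n d A l) (C : SafePartition X ι)
    (P : Measure S.W) [IsProbabilityMeasure P] (x : Fin n → ℝ) (a : A) (q : Option ι) :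
    discreteTransition S C P x a q = P (S.f a x ⁻¹' C.region q) :=
  lintegral_indicator_one ((S.continuous_f a x).measurable (C.measurable_region q))

theorem sum_mul_toPMF {Z : Type*} [Fintype Z] [MeasurableSpace Z] [MeasurableSingletonClass Z]
    (ν : Measure Z) [IsProbabilityMeasure ν] (c : Z → ℝ≥0∞) :
    ∑ z, c z * ν.toPMF z = ∫⁻ z, c z ∂ν := by
  simp only [Measure.toPMF_apply]
  rw [lintegral_fintype]

/-- A coupling of `P` and the empirical distribution of the disturbances with cost at most `ε ^ s`
puts the transition probabilities of the abstraction into the ambiguity set. -/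
theorem discreteTransition_mem_ambiguitySet (S : SwitchedSystem n d A l)
    (C : SafePartition X ι) (P : Measure S.W) [IsProbabilityMeasure P] (s : ℕ) (ε : ℝ)
    (w : Fin N → S.W) (π : Measure (S.W × S.W)) (h1 : π.map Prod.fst = P)
    (h2 : π.map Prod.snd = empirical w)
    (hcost : ∫⁻ z, normCost l s (z.1 : Fin d → ℝ) (z.2 : Fin d → ℝ) ∂π ≤ ENNReal.ofReal ε ^ s)
    {x : Fin n → ℝ} (hx : x ∈ X) {q : Option ι} (hq : x ∈ C.region q) (a : A) :
    discreteTransition S C P x a ∈ ambiguitySet S C s ε w q a := by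
  classical
  cases q with
  | none => exact absurd hx hq
  | some i =>
    let _ : MeasurableSpace (Option ι) := ⊤
    have _ : DiscreteMeasurableSpace (Option ι) := ⟨fun _ => trivial⟩
    have hπ : IsProbabilityMeasure π := by
      refine ⟨?_⟩
      rw [← Set.preimage_univ (f := Prod.fst), ← Measure.map_apply measurable_fst
        MeasurableSet.univ, h1, measure_univ]
    set r : S.W → Option ι := fun v => SafePartition.index C (S.f a x v) with hr
    have hpre : ∀ q, r ⁻¹' {q} = S.f a x ⁻¹' C.region q := fun q => by
      ext v
      exact SafePartition.index_eq_iff C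
    have hrm : Measurable r := measurable_to_countable' fun q => by
      rw [hpre]
      exact (S.continuous_f a x).measurable (C.measurable_region q)
    have hrr : Measurable (Prod.map r r) := hrm.prodMap hrm
    -- Both coordinates are moved with the same `x`, so the Lipschitz bound in the disturbance
    -- controls the cost.
    set ν := π.map (Prod.map r r) with hν
    have hνp : IsProbabilityMeasure ν := Measure.isProbabilityMeasure_map hrr.aemeasurable
    have hfst : ν.toPMF.map Prod.fst = discreteTransition S C P x a := by
      ext q
      rw [discreteTransition_apply, ← hpre, ← h1,
        Measure.map_apply measurable_fst (hrm (measurableSet_singleton q)),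
        ← PMF.toMeasure_apply_singleton _ _ (measurableSet_singleton q),
        ← PMF.toMeasure_map _ _ measurable_fst, Measure.toPMF_toMeasure,
        Measure.map_apply measurable_fst (measurableSet_singleton q), hν,
        Measure.map_apply hrr (measurable_fst (measurableSet_singleton q))]
      rfl
    have hsnd : ∀ q, ν.toPMF.map Prod.snd q
        = ((Finset.univ.filter fun k => S.f a x (w k) ∈ C.region q).card : ℝ≥0∞) / N := by
      intro q
      have hqm := hrm (measurableSet_singleton q)
      rw [← PMF.toMeasure_apply_singleton _ _ (measurableSet_singleton q),
        ← PMF.toMeasure_map _ _ measurable_snd, Measure.toPMF_toMeasure,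
        Measure.map_apply measurable_snd (measurableSet_singleton q), hν,
        Measure.map_apply hrr (measurable_snd (measurableSet_singleton q))]
      have : Prod.map r r ⁻¹' (Prod.snd ⁻¹' {q}) = Prod.snd ⁻¹' (r ⁻¹' {q}) := rfl
      rw [this, ← Measure.map_apply measurable_snd hqm, h2, empirical, Measure.smul_apply,
        Measure.finsetSum_apply, smul_eq_mul, ENNReal.div_eq_inv_mul]
      congr 1
      simp only [hpre]
      simp [Set.indicator_apply]
    -- As `x ∈ q`, the point `f_a(x, w k)` belongs to the reach set: it lies in every region
    -- containing that set, and any region it lies in meets that set.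
    refine ⟨ν.toPMF.map Prod.snd, fun q => ?_, ?_⟩
    · rw [hsnd]
      refine ⟨ENNReal.div_le_div_right ?_ _, ENNReal.div_le_div_right ?_ _⟩
      · rw [← Set.ncard_coe_finset]
        refine Nat.cast_le.2 (Set.ncard_le_ncard (fun k hk => ?_) (Set.toFinite _))
        simpa using hk ⟨x, hq, rfl⟩
      · rw [← Set.ncard_coe_finset]
        refine Nat.cast_le.2 (Set.ncard_le_ncard (fun k hk => ?_) (Set.toFinite _))
        exact ⟨_, ⟨x, hq, rfl⟩, by simpa using hk⟩
    · refine iInf_le_of_le ν.toPMF (iInf_le_of_le hfst (iInf_le_of_le rfl ?_))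
      rw [sum_mul_toPMF ν fun z => C.cost l s z.1 z.2, hν,
        lintegral_map (measurable_of_countable _) hrr]
      calc ∫⁻ z, C.cost l s (r z.1) (r z.2) ∂π
          ≤ ∫⁻ z, (S.Lw x a : ℝ≥0∞) ^ s
              * normCost l s (z.1 : Fin d → ℝ) (z.2 : Fin d → ℝ) ∂π :=
            lintegral_mono fun z => (SafePartition.cost_index_le C s _ _).trans
              (normCost_f_le S s a x z.1 z.2)
        _ = (S.Lw x a : ℝ≥0∞) ^ s
              * ∫⁻ z, normCost l s (z.1 : Fin d → ℝ) (z.2 : Fin d → ℝ) ∂π :=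
            lintegral_const_mul _ (measurable_normCost_subtype s)
        _ ≤ (S.Lw x a : ℝ≥0∞) ^ s * ENNReal.ofReal ε ^ s := by gcongr
        _ ≤ (cellLipschitz S C (some i) a * ENNReal.ofReal ε) ^ s := by
            rw [← mul_pow]
            gcongr
            exact le_iSup₂_of_le x hq le_rfl

end Abstraction

/-! ### Concentration of the transport cost -/

/-- Deviation of the transport cost to the empirical distribution from an upper bound `g` of its
mean. -/
theorem measure_transportCost_ge_le {d N : ℕ} {l : ℝ≥0∞} [Fact (1 ≤ l)]
    {V : Set (Fin d → ℝ)} (hN : N ≠ 0) (s : ℕ) (hV : Bornology.IsBounded V)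
    (P : Measure V) [IsProbabilityMeasure P] (g : ℝ≥0) (hg : meanCost N l s P ≤ g)
    {D : ℝ} (hD : D = ((d : ℝ) ^ (1 / l).toReal * Metric.diam V) ^ s) {t : ℝ} (ht : 0 ≤ t) :
    (Measure.pi fun _ : Fin N => P).real
        {w | ENNReal.ofReal (g + t) ≤ transportCost l s P (empirical w)}
      ≤ Real.exp (-2 * N * t ^ 2 / D ^ 2) := by
  have hNr : (N : ℝ) ≠ 0 := by exact_mod_cast hN
  have hD0 : 0 ≤ D := by rw [hD]; positivity
  set T : (Fin N → V) → ℝ≥0∞ := fun w => transportCost l s P (empirical w) with hT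
  have hTm : Measurable T := measurable_transportCost_empirical hN s hV P
  have hTD : ∀ w, T w ≤ ENNReal.ofReal D := fun w => hD ▸ transportCost_empirical_le hN s hV P w
  have hTt : ∀ w, T w ≠ ∞ := fun w => ((hTD w).trans_lt ENNReal.ofReal_lt_top).ne
  set F : (Fin N → V) → ℝ := fun w => (T w).toReal with hF
  have hFm : Measurable F := hTm.ennreal_toReal
  have hFB : ∀ w, |F w| ≤ D := fun w => by
    rw [abs_of_nonneg ENNReal.toReal_nonneg]
    exact ENNReal.toReal_le_of_le_ofReal hD0 (hTD w)
  obtain ⟨c, hc⟩ : ∃ c : ℝ≥0, (c : ℝ) = D / N := ⟨⟨D / N, by positivity⟩, rfl⟩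
  have hFc : ∀ w i v, F (Function.update w i v) ≤ F w + c := by
    intro w i v
    have h := transportCost_empirical_update_le (l := l) hN s hV P w i v
    rw [← hD] at h
    have h2 : (N : ℝ≥0∞)⁻¹ * ENNReal.ofReal D ≠ ∞ :=
      ENNReal.mul_ne_top (ENNReal.inv_ne_top.2 (by exact_mod_cast hN)) ENNReal.ofReal_ne_top
    have h3 := ENNReal.toReal_mono (ENNReal.add_ne_top.2 ⟨hTt w, h2⟩) h
    rw [ENNReal.toReal_add (hTt w) h2, ENNReal.toReal_mul, ENNReal.toReal_inv,
      ENNReal.toReal_natCast, ENNReal.toReal_ofReal hD0] at h3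
    have h4 : (c : ℝ) = (N : ℝ)⁻¹ * D := by
      rw [hc]
      ring
    rw [h4]
    exact h3
  have hmean : ∫ w, F w ∂(Measure.pi fun _ : Fin N => P) ≤ g := by
    rw [integral_toReal hTm.aemeasurable (Filter.Eventually.of_forall fun w => (hTt w).lt_top)]
    exact ENNReal.toReal_le_of_le_ofReal g.2 (by simpa [meanCost] using hg)
  have hsub := hasSubgaussianMGF_pi_of_boundedDifference P hFm hFB hFc
  refine (measureReal_mono (fun w hw => ?_) (measure_ne_top _ _)).trans
    ((hsub.measure_ge_le ht).trans (Real.exp_le_exp.2 (le_of_eq ?_)))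
  · have h : ENNReal.ofReal (g + t) ≤ T w := hw
    have h' : g + t ≤ F w := (ENNReal.ofReal_le_iff_le_toReal (hTt w)).1 h
    simp only [Set.mem_ofPred_eq]
    linarith
  · push_cast
    rw [hc]
    -- For `D = 0` both exponents are `0` by the convention on division, and the bound is the
    -- trivial one.
    by_cases hz : D = 0
    · simp [hz]
    · field_simp

/-- The deviation of the transport cost which has probability at most `β` is covered by the
radius. -/
theorem add_deviation_le_radius_pow {N d s : ℕ} (hN : N ≠ 0) (hs : s ≠ 0) {l : ℝ≥0∞} {β φ : ℝ}
    (hβ0 : 0 < β) (hβ1 : β < 1) (hφ : 0 ≤ φ) (g : ℝ≥0) :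
    g + ((d : ℝ) ^ (1 / l).toReal * φ) ^ s * Real.sqrt (Real.log (1 / β) / (2 * N))
      ≤ radius N β φ d s l g ^ s := by
  set L := Real.log (1 / β) with hL
  have hL0 : 0 ≤ L := Real.log_nonneg (by rw [le_div_iff₀ hβ0]; linarith)
  set b : ℝ := (d : ℝ) ^ (1 / l).toReal with hb
  have hb0 : 0 ≤ b := by positivity
  have hsr : (s : ℝ) ≠ 0 := by exact_mod_cast hs
  have hN0 : (0 : ℝ) < N := by exact_mod_cast Nat.pos_of_ne_zero hN
  -- The second summand of the radius with `κ` replaced by `2 ^ (-1/s) d ^ (1/l)`, the value for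
  -- which `u ^ s` is exactly the deviation.
  set u : ℝ := φ * ((2 : ℝ) ^ (-(1 / (s : ℝ))) * b) * (2 * L) ^ (1 / (2 * (s : ℝ)))
      * (N : ℝ) ^ (-(1 / (2 * (s : ℝ)))) with hu
  have hu0 : 0 ≤ u := by positivity
  have hle : (g : ℝ) ^ (1 / (s : ℝ)) + u ≤ radius N β φ d s l g := by
    rw [radius, hu]
    gcongr
    exact le_max_right _ _
  have hg0 : (0 : ℝ) ≤ (g : ℝ) ^ (1 / (s : ℝ)) := by positivity
  have hgs : ((g : ℝ) ^ (1 / (s : ℝ))) ^ s = g := by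
    rw [one_div, Real.rpow_inv_natCast_pow g.coe_nonneg hs]
  have hhalf : ∀ y : ℝ, 0 ≤ y → (y ^ (1 / (2 * (s : ℝ)))) ^ s = Real.sqrt y := by
    intro y hy
    rw [← Real.rpow_natCast, ← Real.rpow_mul hy, Real.sqrt_eq_rpow]
    congr 1
    field_simp
  have hus : u ^ s = (b * φ) ^ s * Real.sqrt (L / (2 * N)) := by
    rw [hu, mul_pow, mul_pow, hhalf _ (by positivity), Real.rpow_neg hN0.le, inv_pow,
      hhalf _ hN0.le, mul_pow, mul_pow, Real.rpow_neg zero_le_two, inv_pow, one_div,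
      Real.rpow_inv_natCast_pow zero_le_two hs]
    -- The factor `1/2` coming from `(2 ^ (-1/s)) ^ s` enters the root as `1 / 2 ^ 2`.
    have h4 : L / (2 * N) = (2 * L) / (2 ^ 2 * N) := by field_simp
    rw [h4, Real.sqrt_div (by positivity), Real.sqrt_mul (by positivity) (N : ℝ),
      Real.sqrt_sq zero_le_two, mul_pow]
    field_simp
  calc g + (b * φ) ^ s * Real.sqrt (L / (2 * N)) = ((g : ℝ) ^ (1 / (s : ℝ))) ^ s + u ^ s := by
        rw [hgs, hus]
    _ ≤ ((g : ℝ) ^ (1 / (s : ℝ)) + u) ^ s := pow_add_pow_le hg0 hu0 hs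
    _ ≤ radius N β φ d s l g ^ s := by gcongr

theorem radius_nonneg {N d s : ℕ} {l : ℝ≥0∞} {β φ : ℝ} (hβ0 : 0 < β) (hβ1 : β < 1) (hφ : 0 ≤ φ)
    (g : ℝ≥0) : 0 ≤ radius N β φ d s l g := by
  have hL0 : 0 ≤ Real.log (1 / β) := Real.log_nonneg (by rw [le_div_iff₀ hβ0]; linarith)
  have hk : 0 ≤ radiusFactor d s l := (Real.sqrt_nonneg _).trans (le_max_left _ _)
  rw [radius]
  positivity

/-! ### Soundness of the abstraction -/

theorem mainTheorem3 {n d N s : ℕ} (hN : 1 ≤ N) (hs : 1 ≤ s) {l : ℝ≥0∞} [Fact (1 ≤ l)]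
    {A ι : Type*} [Fintype A] [Fintype ι]
    (S : SwitchedSystem n d A l) (P : Measure S.W) [IsProbabilityMeasure P]
    {X : Set (Fin n → ℝ)} (hX : Bornology.IsBounded X) (C : SafePartition X ι)
    {β : ℝ} (hβ0 : 0 < β) (hβ1 : β < 1)
    (g : ℝ≥0) (hg : meanCostBound N (Metric.diam S.W) d s l ≤ g)
    {Ω : Type*} [MeasurableSpace Ω] (μ : Measure Ω) [IsProbabilityMeasure μ]
    (w : Fin N → Ω → S.W) (hw : ∀ i, Measurable (w i)) (hind : iIndepFun w μ)
    (hlaw : ∀ i, μ.map (w i) = P) :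
    ∃ E : Set Ω, MeasurableSet E ∧ ENNReal.ofReal (1 - β) ≤ μ E ∧
      ∀ ω ∈ E, ∀ x ∈ X, ∀ q : Option ι, x ∈ C.region q → ∀ a : A,
        discreteTransition S C P x a ∈
          ambiguitySet S C s (radius N β (Metric.diam S.W) d s l g) (fun i => w i ω) q a := by
  have hN' : N ≠ 0 := by omega
  have hs' : s ≠ 0 := by omega
  set φ := Metric.diam S.W with hφ
  have hφ0 : 0 ≤ φ := Metric.diam_nonneg
  set D : ℝ := ((d : ℝ) ^ (1 / l).toReal * φ) ^ s with hD
  have hD0 : 0 ≤ D := by positivity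
  -- For `D = 0` the tail bound is void, but every cost vanishes, so the independent coupling works
  -- for every outcome.
  rcases hD0.eq_or_lt with hDz | hDpos
  · refine ⟨Set.univ, MeasurableSet.univ, ?_, fun ω _ x hx q hq a => ?_⟩
    · rw [measure_univ]
      exact ENNReal.ofReal_le_one.2 (by linarith)
    · set ρ : Fin N → Measure S.W := fun _ => P with hρ
      refine discreteTransition_mem_ambiguitySet S C P s _ _
        (mixture (fun i => w i ω) ρ) ?_ (map_snd_mixture _ _) ?_ hx hq a
      · have hN0 : (N : ℝ≥0∞) ≠ 0 := by exact_mod_cast hN'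
        rw [map_fst_mixture, hρ, Finset.sum_const, Finset.card_univ, Fintype.card_fin,
          ← Nat.cast_smul_eq_nsmul ℝ≥0∞, smul_smul,
          ENNReal.inv_mul_cancel hN0 (ENNReal.natCast_ne_top N), one_smul]
      · have h0 : ∀ z : S.W × S.W,
            normCost l s (z.1 : Fin d → ℝ) (z.2 : Fin d → ℝ) = 0 := fun z => by
          have := normCost_le l s S.bounded z.1 z.2
          rw [← hφ, ← hD, ← hDz, ENNReal.ofReal_zero] at this
          exact le_antisymm this zero_le
        simp [h0]
  · have hL : 0 < Real.log (1 / β) := Real.log_pos (by rw [lt_div_iff₀ hβ0]; linarith)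
    have hNr : (0 : ℝ) < N := by exact_mod_cast hN
    -- The solution of `exp (-2 N t ^ 2 / D ^ 2) = β`.
    set t : ℝ := D * Real.sqrt (Real.log (1 / β) / (2 * N)) with ht
    have ht0 : 0 ≤ t := by positivity
    have hgP : meanCost N l s P ≤ g := by
      refine le_trans ?_ hg
      exact le_iSup_of_le S.W (le_iSup_of_le S.bounded (le_iSup_of_le le_rfl
        (le_iSup_of_le (⟨P, inferInstance⟩ : ProbabilityMeasure S.W) le_rfl)))
    set T : (Fin N → S.W) → ℝ≥0∞ := fun u => transportCost l s P (empirical u) with hT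
    have hTm : Measurable T := measurable_transportCost_empirical hN' s S.bounded P
    set B : Set (Fin N → S.W) := {u | ENNReal.ofReal (g + t) ≤ T u} with hB
    have hBm : MeasurableSet B := measurableSet_le measurable_const hTm
    have hBβ : (Measure.pi fun _ : Fin N => P).real B ≤ β := by
      refine (measure_transportCost_ge_le hN' s S.bounded P g hgP hD ht0).trans (le_of_eq ?_)
      have : -2 * N * t ^ 2 / D ^ 2 = Real.log β := by
        rw [ht, mul_pow, Real.sq_sqrt (by positivity), one_div, Real.log_inv]
        field_simp
      rw [this, Real.exp_log hβ0]
    have hWm : Measurable fun ω i => w i ω := measurable_pi_iff.2 hw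
    have hmap : μ.map (fun ω i => w i ω) = Measure.pi fun _ : Fin N => P := by
      rw [(iIndepFun_iff_map_fun_eq_pi_map fun i => (hw i).aemeasurable).1 hind]
      simp only [hlaw]
    refine ⟨(fun ω i => w i ω) ⁻¹' Bᶜ, hWm hBm.compl, ?_, fun ω hω x hx q hq a => ?_⟩
    · rw [← Measure.map_apply hWm hBm.compl, hmap]
      refine ENNReal.ofReal_le_of_le_toReal ?_
      have := probReal_compl_eq_one_sub (μ := Measure.pi fun _ : Fin N => P) hBm
      rw [Measure.real] at this
      rw [this]
      linarith
    · have hlt : transportCost l s P (empirical fun i => w i ω) < ENNReal.ofReal (g + t) :=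
        not_le.1 hω
      -- The bad event is defined by `≤`, so its complement gives a strict inequality, hence an
      -- actual coupling; no minimiser has to exist.
      simp only [transportCost, iInf_lt_iff] at hlt
      obtain ⟨π, h1, h2, hπ⟩ := hlt
      refine discreteTransition_mem_ambiguitySet S C P s _ _ π h1 h2 ?_ hx hq a
      refine hπ.le.trans ?_
      rw [← ENNReal.ofReal_pow (radius_nonneg hβ0 hβ1 hφ0 g)]
      exact ENNReal.ofReal_le_ofReal (add_deviation_le_radius_pow hN' hs' hβ0 hβ1 hφ0 g)
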